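/- **Setting.** Let $\mathbb{C}\{\{t^*\}\}$ be the field of convergent generalised Puiseux series: the field of fractions of the ring of series $\sum_a c_a t^a$ with $c_a\in\mathbb{C}$, exponents $a$ in a set $A\subseteq[0,\infty)$ such that $A\cap[0,R]$ is finite for all $R>0$, and $\sum_a |c_a| r^a<\infty$ for some $r>0$. Likewise let $\mathbb{C}\{\{(t,u)^*\}\}$ be the field of fractions of the ring of series $\sum c_{a,b}t^a u^b$ with $c_{a,b}\in\mathbb{C}$ and support in a product $A\times B$ of two such sets, and $\sum |c_{a,b}| r^a s^b<\infty$ for some $r,s>0$. Let $\mathrm{val}$ be the valuation of $\mathbb{C}\{\{t^*\}\}$ with values in $\mathbb{R}$ that sends a nonzero series to its least exponent, and let $\mathrm{val}_2$ be the valuation of $\mathbb{C}\{\{(t,u)^*\}\}$ with values in $\mathbb{R}^2$ with the lexicographic ordering (the exponent of $t$ first) that sends a nonzero series to its least exponent. We regard $\mathbb{C}\{\{t^*\}\}$ as a subfield of $\mathbb{C}\{\{(t,u)^*\}\}$. For a Laurent polynomial $f=\sum_s\gamma_s x^s$ in $x_1,\dots,x_d$ over $\mathbb{C}\{\{t^*\}\}$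 and $p\in\mathbb{R}^d$, let $D_p(f)$ be the set of those $s\in\mathrm{supp}(f)$ at which $\mathrm{val}(\gamma_s)+\sum_i s_ip_i$ attains its minimum over $\mathrm{supp}(f)$. The rank one tropical hypersurface is $\mathcal{T}(f)=\{p\in\mathbb{R}^d : |D_p(f)|>1\}$, and its cells are the nonempty polyhedra $\{p : S\subseteq D_p(f)\}$ for $S\subseteq\mathrm{supp}(f)$ with $|S|>1$. The rank two tropical hypersurface $\mathcal{T}_2(F)\subseteq(\mathbb{R}^2)^d=\mathbb{R}^{2d}$ of a Laurent polynomial $F$ over $\mathbb{C}\{\{(t,u)^*\}\}$ is defined in the same way, with $\mathrm{val}_2$ and the lexicographic minimum. (These sets are empty if the polynomial has fewer than two terms, in particular if it is zero.) The polyhedral stable intersection of $\mathcal{T}(f)$ and $\mathcal{T}(g)$ is $$\mathcal{T}(f)\cap_{\mathrm{st}}\mathcal{T}(g)=\bigcup_{\dim(P+Q)=d}(P\cap Q),$$ where $P$ and $Q$ range over the cells of $\mathcal{T}(f)$ and of $\mathcal{T}(g)$, respectively. **Theorem.** Let $\beta>0$ be a transcendental real number, let $d\ge 0$, and let $f,g\in\mathbb{C}\{\{t^*\}\}[x_1^{\pm},\dots,x_d^{\pm}]$.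 Let $g^u$ be the Laurent polynomial over $\mathbb{C}\{\{(t,u)^*\}\}$ obtained from $g$ by the substitutions $x_k\mapsto u^{\beta^k}x_k$ for $k=1,\dots,d$. Then $$\mathcal{T}(f)\cap_{\mathrm{st}}\mathcal{T}(g)=\pi_{u*}\Bigl(\overline{\mathcal{T}_2(f)}\cap\overline{\mathcal{T}_2(g^u)}\Bigr),$$ where the closures are taken in the Euclidean topology of $\mathbb{R}^{2d}$ and $\pi_{u*}:\mathbb{R}^{2d}\to\mathbb{R}^d$ is the projection $(p_{11},p_{21};\dots;p_{1d},p_{2d})\mapsto(p_{11},\dots,p_{1d})$. -/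

import Mathlib

open scoped Pointwise

namespace RankTwo

noncomputable section

/-! ### Convergent generalised Puiseux series

Formal series in `t` (resp. in `t, u`) with real exponents and complex coefficients are Hahn series
over `ℝ` (resp. over `ℝ × ℝ` with the lexicographic ordering, `t` before `u`).  -/

/-- A set of nonnegative reals which meets every interval `[0, R]` in a finite set. -/
def IsLocallyFiniteExponents (A : Set ℝ) : Prop :=
  A ⊆ Set.Ici 0 ∧ ∀ R : ℝ, 0 < R → (A ∩ Set.Icc 0 R).Finite

/-- `γ` is a convergent power series in `t` with exponents in `[0, ∞)`: its support is locally
finite, and `∑ |c_a| r ^ a < ∞` for some radius `r > 0`. -/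
def IsConvergent₁ (γ : HahnSeries ℝ ℂ) : Prop :=
  (∃ A : Set ℝ, IsLocallyFiniteExponents A ∧ γ.support ⊆ A) ∧
  ∃ r : ℝ, 0 < r ∧ Summable fun a : ℝ => ‖γ.coeff a‖ * r ^ a

/-- `γ` is a convergent power series in `t, u` with exponents in `[0, ∞) ^ 2`: its support is
contained in a product `A × B` of locally finite sets, and `∑ |c_(a,b)| r ^ a s ^ b < ∞` for some
polyradius `(r, s)`. -/
def IsConvergent₂ (γ : HahnSeries (ℝ ×ₗ ℝ) ℂ) : Prop :=
  (∃ A B : Set ℝ, IsLocallyFiniteExponents A ∧ IsLocallyFiniteExponents B ∧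
    ∀ e ∈ γ.support, (ofLex e).1 ∈ A ∧ (ofLex e).2 ∈ B) ∧
  ∃ r s : ℝ, 0 < r ∧ 0 < s ∧
    Summable fun e : ℝ × ℝ => ‖γ.coeff (toLex e)‖ * (r ^ e.1 * s ^ e.2)

/-- The field `ℂ{{t*}}`: the convergent series form a ring, and the subfield of the field of Hahn
series that they generate is its field of fractions. -/
def Puiseux₁ : Subfield (HahnSeries ℝ ℂ) := Subfield.closure {γ | IsConvergent₁ γ}

/-- The field `ℂ{{(t,u)*}}`: the convergent series in `t, u` form a ring, and the subfield of the
field of Hahn series that they generate is its field of fractions. -/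
def Puiseux₂ : Subfield (HahnSeries (ℝ ×ₗ ℝ) ℂ) := Subfield.closure {γ | IsConvergent₂ γ}

/-- The valuation `val` of `ℂ{{t*}}`: the least exponent (only used for nonzero elements). -/
def val₁ (γ : Puiseux₁) : ℝ := (γ : HahnSeries ℝ ℂ).order

/-- The rank two valuation `val₂` of `ℂ{{(t,u)*}}`: the lexicographically least exponent
(only used for nonzero elements). -/
def val₂ (γ : Puiseux₂) : ℝ ×ₗ ℝ := (γ : HahnSeries (ℝ ×ₗ ℝ) ℂ).order

/-- The map `a ↦ (a, 0)` on exponents. -/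
def exponentEmb : ℝ →+ ℝ ×ₗ ℝ where
  toFun a := toLex (a, 0)
  map_zero' := rfl
  map_add' a b := by
    rw [← toLex_add, Prod.mk_add_mk, add_zero]

theorem exponentEmb_injective : Function.Injective exponentEmb := fun _ _ h =>
  congrArg (fun e : ℝ ×ₗ ℝ => (ofLex e).1) h

theorem exponentEmb_le_iff (a b : ℝ) : exponentEmb a ≤ exponentEmb b ↔ a ≤ b := by
  change toLex (a, (0 : ℝ)) ≤ toLex (b, (0 : ℝ)) ↔ a ≤ b
  rw [Prod.Lex.toLex_le_toLex]
  simp [le_iff_lt_or_eq]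

/-- The embedding of Hahn series in `t` into Hahn series in `t, u` induced by `a ↦ (a, 0)`. -/
def hahnEmb : HahnSeries ℝ ℂ →+* HahnSeries (ℝ ×ₗ ℝ) ℂ :=
  HahnSeries.embDomainRingHom exponentEmb exponentEmb_injective exponentEmb_le_iff

theorem hahnEmb_coeff (γ : HahnSeries ℝ ℂ) (a : ℝ) :
    (hahnEmb γ).coeff (toLex (a, 0)) = γ.coeff a :=
  HahnSeries.embDomain_coeff (f := ⟨⟨exponentEmb, exponentEmb_injective⟩, exponentEmb_le_iff _ _⟩)

theorem hahnEmb_coeff_of_ne (γ : HahnSeries ℝ ℂ) (a b : ℝ) (hb : b ≠ 0) :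
    (hahnEmb γ).coeff (toLex (a, b)) = 0 := by
  refine HahnSeries.embDomain_of_notMem_range
    (f := ⟨⟨exponentEmb, exponentEmb_injective⟩, exponentEmb_le_iff _ _⟩) ?_
  rintro ⟨c, hc⟩
  exact hb (congrArg (fun e : ℝ ×ₗ ℝ => (ofLex e).2) hc).symm

theorem isLocallyFiniteExponents_singleton {b : ℝ} (hb : 0 ≤ b) :
    IsLocallyFiniteExponents {b} :=
  ⟨by simpa using hb, fun _ _ => (Set.finite_singleton b).inter_of_left _⟩

theorem IsConvergent₁.hahnEmb {γ : HahnSeries ℝ ℂ} (h : IsConvergent₁ γ) :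
    IsConvergent₂ (hahnEmb γ) := by
  obtain ⟨⟨A, hA, hs⟩, r, hr, hsum⟩ := h
  refine ⟨⟨A, {0}, hA, isLocallyFiniteExponents_singleton le_rfl, ?_⟩, r, 1, hr, one_pos, ?_⟩
  · intro e he
    rcases e with ⟨a, b⟩
    change (RankTwo.hahnEmb γ).coeff (toLex (a, b)) ≠ 0 at he
    by_cases hb : b = 0
    · subst hb
      rw [hahnEmb_coeff] at he
      exact ⟨hs he, rfl⟩
    · exact absurd (hahnEmb_coeff_of_ne γ a b hb) he
  · have hinj : Function.Injective fun a : ℝ => (a, (0 : ℝ)) := fun a b h => congrArg Prod.fst h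
    rw [← hinj.summable_iff]
    · simpa [Function.comp_def, hahnEmb_coeff] using hsum
    · rintro ⟨a, b⟩ hab
      have hb : b ≠ 0 := fun hb => hab ⟨a, by rw [hb]⟩
      simp [hahnEmb_coeff_of_ne γ a b hb]

/-- The embedding `ι : ℂ{{t*}} → ℂ{{(t,u)*}}`. -/
def iota : Puiseux₁ →+* Puiseux₂ :=
  (hahnEmb.comp Puiseux₁.subtype).codRestrict Puiseux₂ fun γ => by
    have h : Puiseux₁ ≤ Puiseux₂.comap hahnEmb :=
      Subfield.closure_le.2 fun γ hγ => Subfield.subset_closure (IsConvergent₁.hahnEmb hγ)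
    exact h γ.2

theorem isConvergent₂_single {b : ℝ} (hb : 0 ≤ b) :
    IsConvergent₂ (HahnSeries.single (toLex ((0 : ℝ), b)) (1 : ℂ)) := by
  refine ⟨⟨{0}, {b}, isLocallyFiniteExponents_singleton le_rfl,
    isLocallyFiniteExponents_singleton hb, ?_⟩, 1, 1, one_pos, one_pos, ?_⟩
  · intro e he
    have he' := HahnSeries.support_single_subset he
    rw [Set.mem_singleton_iff] at he'
    subst he'
    exact ⟨rfl, rfl⟩
  · refine summable_of_ne_finset_zero (s := {((0 : ℝ), b)}) fun e he => ?_
    rw [HahnSeries.coeff_single_of_ne (by simpa using he)]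
    simp

theorem single_mem_puiseux₂ (b : ℝ) :
    HahnSeries.single (toLex ((0 : ℝ), b)) (1 : ℂ) ∈ Puiseux₂ := by
  rcases le_total 0 b with hb | hb
  · exact Subfield.subset_closure (isConvergent₂_single hb)
  · have h := Puiseux₂.inv_mem
      (Subfield.subset_closure (isConvergent₂_single (neg_nonneg.2 hb)))
    rw [HahnSeries.inv_single, inv_one, ← toLex_neg, Prod.neg_mk, neg_neg, neg_zero] at h
    exact h

/-- The monomial `u ^ b`, for a real exponent `b`. -/
def uPow (b : ℝ) : Puiseux₂ := ⟨HahnSeries.single (toLex (0, b)) 1, single_mem_puiseux₂ b⟩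

theorem uPow_ne_zero (b : ℝ) : uPow b ≠ 0 := fun h =>
  HahnSeries.single_ne_zero (one_ne_zero (α := ℂ)) (congrArg Subtype.val h)

/-! ### Laurent polynomials and their perturbation -/

/-- Laurent polynomials in `x_1, …, x_d` over `K`; the monomial `c x ^ s` is
`AddMonoidAlgebra.single s c`. -/
abbrev Laurent (K : Type*) [Semiring K] (d : ℕ) : Type _ := AddMonoidAlgebra K (Fin d → ℤ)

/-- The unit `c x_k` of the ring of Laurent polynomials, for `c ≠ 0`. -/
def scaledVar {K : Type*} [Field K] {d : ℕ} (c : K) (hc : c ≠ 0) (k : Fin d) :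
    (Laurent K d)ˣ where
  val := AddMonoidAlgebra.single (Pi.single k 1) c
  inv := AddMonoidAlgebra.single (-Pi.single k 1) c⁻¹
  val_inv := by
    rw [AddMonoidAlgebra.single_mul_single, add_neg_cancel, mul_inv_cancel₀ hc]; rfl
  inv_val := by
    rw [AddMonoidAlgebra.single_mul_single, neg_add_cancel, inv_mul_cancel₀ hc]; rfl

/-- The substitution `x_k ↦ y_k` of units for the variables of a Laurent polynomial. -/
def substUnits {K : Type*} [Field K] {d : ℕ} (y : Fin d → (Laurent K d)ˣ) :
    Laurent K d →ₐ[K] Laurent K d :=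
  AddMonoidAlgebra.lift K (Laurent K d) (Fin d → ℤ)
    { toFun := fun s => ((∏ k, y k ^ (Multiplicative.toAdd s k) : (Laurent K d)ˣ) : Laurent K d)
      map_one' := by simp
      map_mul' := fun s s' => by
        simp [zpow_add, Finset.prod_mul_distrib] }

/-- A Laurent polynomial over `ℂ{{t*}}`, considered over `ℂ{{(t,u)*}}`. -/
def extendScalars {d : ℕ} (f : Laurent Puiseux₁ d) : Laurent Puiseux₂ d :=
  AddMonoidAlgebra.mapRingHom (Fin d → ℤ) iota f

/-- The `u`-perturbation of `f` by `β`: the substitution `x_k ↦ u ^ (β ^ k) x_k`, `k = 1, …, d`. -/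
def uPerturbation (β : ℝ) {d : ℕ} (f : Laurent Puiseux₁ d) : Laurent Puiseux₂ d :=
  substUnits (fun k => scaledVar (uPow (β ^ ((k : ℕ) + 1))) (uPow_ne_zero _) k) (extendScalars f)

/-! ### Tropical hypersurfaces -/

section Tropical

variable {K Γ : Type*} [Field K] [AddCommGroup Γ] [LinearOrder Γ] {d : ℕ}

/-- The value `val (γ_s) + ⟨s, p⟩` at `p` of the term of `trop f` with exponent `s`. -/
def tropTerm (v : K → Γ) (f : Laurent K d) (p : Fin d → Γ) (s : Fin d → ℤ) : Γ :=
  v (f.coeff s) + ∑ i, s i • p i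

/-- The set `D_p(f)` of the exponents in the support of `f` at which the minimum
`trop f (p)` is attained. -/
def minimizers (v : K → Γ) (f : Laurent K d) (p : Fin d → Γ) : Set (Fin d → ℤ) :=
  {s | s ∈ f.coeff.support ∧ ∀ s' ∈ f.coeff.support, tropTerm v f p s ≤ tropTerm v f p s'}

/-- The tropical hypersurface of `f`: the points where the minimum is attained at least twice. -/
def tropHypersurface (v : K → Γ) (f : Laurent K d) : Set (Fin d → Γ) :=
  {p | (minimizers v f p).Nontrivial}

/-- The support cell of a set `S` of exponents. -/
def supportCell (v : K → Γ) (f : Laurent K d) (S : Set (Fin d → ℤ)) : Set (Fin d → Γ) :=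
  {p | S ⊆ minimizers v f p}

/-- The cells of the polyhedral complex that the tropical hypersurface of `f` carries: the
nonempty support cells of sets `S ⊆ supp f` with more than one element. -/
def tropCells (v : K → Γ) (f : Laurent K d) : Set (Set (Fin d → Γ)) :=
  {P | P.Nonempty ∧ ∃ S : Set (Fin d → ℤ),
    S ⊆ (f.coeff.support : Set (Fin d → ℤ)) ∧ S.Nontrivial ∧ P = supportCell v f S}

theorem sUnion_tropCells (v : K → Γ) (f : Laurent K d) :
    ⋃₀ tropCells v f = tropHypersurface v f := by
  ext p
  constructor
  · rintro ⟨P, ⟨-, S, -, hS, rfl⟩, hp⟩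
    exact hS.mono hp
  · intro hp
    have h : p ∈ supportCell v f (minimizers v f p) := Set.Subset.rfl
    exact ⟨supportCell v f (minimizers v f p),
      ⟨⟨p, h⟩, minimizers v f p, fun s hs => hs.1, hp, rfl⟩, h⟩

end Tropical

/-- The dimension of a (nonempty) convex set in `ℝ ^ d`: the dimension of its affine span. -/
def polyDim {d : ℕ} (P : Set (Fin d → ℝ)) : ℕ := Module.finrank ℝ (vectorSpan ℝ P)

/-- The polyhedral stable intersection of the rank one tropical hypersurfaces `T(f)` and `T(g)`
in `ℝ ^ d`, where `T(f)` is `tropHypersurface val₁ f`: the union of the `P ∩ Q`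
over the cells `P` of `T(f)` and `Q` of `T(g)` with `dim (P + Q) = d`. -/
def stableIntersection {d : ℕ} (f g : Laurent Puiseux₁ d) : Set (Fin d → ℝ) :=
  {p | ∃ P ∈ tropCells val₁ f, ∃ Q ∈ tropCells val₁ g, polyDim (P + Q) = d ∧ p ∈ P ∩ Q}

/-- The rank two tropical hypersurface `T₂(F)` as a subset of `(ℝ ^ 2) ^ d`, where `ℝ ^ 2` is
`ℝ × ℝ` with the Euclidean topology (the lexicographic ordering only enters into the minimum). -/
def trop₂ {d : ℕ} (F : Laurent Puiseux₂ d) : Set (Fin d → ℝ × ℝ) :=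
  {p | (fun i => toLex (p i)) ∈ tropHypersurface val₂ F}

/-- The projection `(p_11, p_21; …; p_1d, p_2d) ↦ (p_11, …, p_1d)`. -/
def projU {d : ℕ} (p : Fin d → ℝ × ℝ) : Fin d → ℝ := fun i => (p i).1

end

end RankTwo

/-!
Write `⟨s, y⟩ = ∑ s_i y_i`, and for a set `A` of exponents let `P_A` be its support cell and `A^⊥`
(`equalizer A`) the space of the `y` for which `⟨s, y⟩` is constant on `A`.

Since `val₂` of the coefficient of `x ^ s` in `g^u` is `(val γ_s, ⟨s, w⟩)` with
`w = (β, β ^ 2, …, β ^ d)`, a point `(p, y)` lies in `T₂(g^u)` iff, among the minimizers of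
`trop g` at `p`, the form `⟨·, y + w⟩` attains its minimum at least twice; `T₂(f)` is the case
`w = 0`. As the lexicographic order of pairs is the order of `x + ε y` for small `ε > 0`, the set
of exponents that attain this minimum is itself of the form `A = D_q`, with `q = p + ε (y + w)`. Together
with the convexity of cells this gives the closure of the rank two hypersurface
(`mem_closure_trop₂_iff`): it is the finite union of the products `P_A × (A^⊥ - w)` over the sets
`A = D_q` with more than one element.

So `p` is in the projection of the intersection of the two closures iff there are sets
`A = D_q(f)` and `B = D_r(g)` with `p ∈ P_A ∩ P_B` and `w ∈ A^⊥ + B^⊥`. The direction spaces of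
`P_A` and `P_B` are `A^⊥` and `B^⊥`, so `dim (P_A + P_B) = d` means that `A^⊥ + B^⊥` is the whole
space (`polyDim_add_eq_iff`), and every cell is of the form `P_A` (`exists_supportCell_eq`). It
remains to see that `w` lies in `A^⊥ + B^⊥` only if this is everything (`equalizer_sup_eq_top`):
`A^⊥` and `B^⊥` are rational subspaces, and the coordinates of `w` are linearly independent over
`ℚ` because `β` is transcendental.
-/

namespace RankTwo

open Filter Topology

/-! ### Coefficients and valuations of perturbed polynomials -/

theorem val₂_iota {γ : Puiseux₁} (hγ : γ ≠ 0) : val₂ (iota γ) = toLex (val₁ γ, 0) := by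
  have h : (γ : HahnSeries ℝ ℂ) ≠ 0 := fun h => hγ (Subtype.ext h)
  have h' : hahnEmb (γ : HahnSeries ℝ ℂ) ≠ 0 := (map_ne_zero hahnEmb).2 h
  change (hahnEmb (γ : HahnSeries ℝ ℂ)).order = exponentEmb (γ : HahnSeries ℝ ℂ).order
  rw [← WithTop.coe_inj, HahnSeries.order_eq_orderTop_of_ne_zero h']
  refine (HahnSeries.orderTop_embDomain
    (f := ⟨⟨exponentEmb, exponentEmb_injective⟩, exponentEmb_le_iff _ _⟩)).trans ?_
  rw [← HahnSeries.order_eq_orderTop_of_ne_zero h]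
  rfl

theorem val₂_mul {γ δ : Puiseux₂} (hγ : γ ≠ 0) (hδ : δ ≠ 0) :
    val₂ (γ * δ) = val₂ γ + val₂ δ :=
  HahnSeries.order_mul (fun h => hγ (Subtype.ext h)) fun h => hδ (Subtype.ext h)

theorem val₂_uPow (b : ℝ) : val₂ (uPow b) = toLex (0, b) :=
  HahnSeries.order_single one_ne_zero

theorem uPow_add (a b : ℝ) : uPow (a + b) = uPow a * uPow b := by
  refine Subtype.ext ?_
  change HahnSeries.single (toLex ((0 : ℝ), a + b)) (1 : ℂ) =
    HahnSeries.single (toLex ((0 : ℝ), a)) 1 * HahnSeries.single (toLex ((0 : ℝ), b)) 1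
  rw [HahnSeries.single_mul_single, ← toLex_add, Prod.mk_add_mk, add_zero, one_mul]

/-- The exponential `b ↦ u ^ b`. -/
noncomputable def uPowHom : Multiplicative ℝ →* Puiseux₂ˣ :=
  MonoidHom.toHomUnits
    { toFun := fun b => uPow b.toAdd
      map_one' := rfl
      map_mul' := fun a b => uPow_add a.toAdd b.toAdd }

theorem prod_uPow_zpow {d : ℕ} (b : Fin d → ℝ) (s : Fin d → ℤ) :
    ∏ k, uPow (b k) ^ s k = uPow (∑ k, s k • b k) := by
  have h : ∏ k, uPowHom (.ofAdd (b k)) ^ s k = uPowHom (.ofAdd (∑ k, s k • b k)) := by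
    simp_rw [← map_zpow, ← map_prod, ← ofAdd_zsmul, ← ofAdd_sum]
  have h' := congrArg Units.val h
  simp_rw [Units.coe_prod, Units.val_zpow_eq_zpow_val] at h'
  exact h'

section Subst

variable {K : Type*} [Field K] {d : ℕ}

theorem scaledVar_zpow (c : K) (hc : c ≠ 0) (k : Fin d) (n : ℤ) :
    ((scaledVar c hc k ^ n : (Laurent K d)ˣ) : Laurent K d) =
      AddMonoidAlgebra.single (n • Pi.single k 1) (c ^ n) := by
  cases n with
  | ofNat n =>
    simp [scaledVar, AddMonoidAlgebra.single_pow]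
  | negSucc n =>
    rw [zpow_negSucc, zpow_negSucc, ← inv_pow, Units.val_pow_eq_pow_val, ← inv_pow]
    change AddMonoidAlgebra.single (-Pi.single k 1) c⁻¹ ^ (n + 1) = _
    rw [AddMonoidAlgebra.single_pow, negSucc_zsmul, smul_neg]

theorem prod_scaledVar_zpow (c : Fin d → K) (hc : ∀ k, c k ≠ 0) (s : Fin d → ℤ) :
    ((∏ k, scaledVar (c k) (hc k) k ^ s k : (Laurent K d)ˣ) : Laurent K d) =
      AddMonoidAlgebra.single s (∏ k, c k ^ s k) := by
  rw [Units.coe_prod]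
  simp_rw [scaledVar_zpow]
  rw [AddMonoidAlgebra.prod_single]
  congr 1
  ext i
  simp [Finset.sum_apply, Pi.single_apply]

theorem coeff_substUnits_scaledVar (c : Fin d → K) (hc : ∀ k, c k ≠ 0) (f : Laurent K d)
    (s : Fin d → ℤ) :
    (substUnits (fun k => scaledVar (c k) (hc k) k) f).coeff s =
      f.coeff s * ∏ k, c k ^ s k := by
  induction f using AddMonoidAlgebra.induction_linear with
  | zero => simp
  | add f g hf hg => simp [hf, hg, add_mul]
  | single t a =>
    rw [substUnits, AddMonoidAlgebra.lift_single]
    change (a • ((∏ k, scaledVar (c k) (hc k) k ^ t k : (Laurent K d)ˣ) : Laurent K d)).coeff s = _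
    rw [prod_scaledVar_zpow]
    by_cases h : t = s
    · subst h; simp
    · simp [AddMonoidAlgebra.coeff_single, h]

end Subst

/-- `F` has the same support as `f`, and the valuation of the coefficient of `x ^ s` in `F` is
`(val₁ (γ_s), ⟨s, w⟩)`: as far as `val₂` can tell, `F` arises from `f` by the substitution
`x_k ↦ u ^ (w_k) x_k`. -/
def IsTropicalPerturbation {d : ℕ} (w : Fin d → ℝ) (f : Laurent Puiseux₁ d)
    (F : Laurent Puiseux₂ d) : Prop :=
  (∀ s, F.coeff s = 0 ↔ f.coeff s = 0) ∧
    ∀ s, f.coeff s ≠ 0 → val₂ (F.coeff s) = toLex (val₁ (f.coeff s), ∑ i, s i • w i)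

theorem coeff_extendScalars {d : ℕ} (f : Laurent Puiseux₁ d) (s : Fin d → ℤ) :
    (extendScalars f).coeff s = iota (f.coeff s) := by
  simp [extendScalars]

theorem isTropicalPerturbation_extendScalars {d : ℕ} (f : Laurent Puiseux₁ d) :
    IsTropicalPerturbation 0 f (extendScalars f) := by
  refine ⟨fun s => ?_, fun s hs => ?_⟩
  · rw [coeff_extendScalars, map_eq_zero]
  · simp [coeff_extendScalars, val₂_iota hs]

theorem isTropicalPerturbation_uPerturbation (β : ℝ) {d : ℕ} (f : Laurent Puiseux₁ d) :
    IsTropicalPerturbation (fun k => β ^ ((k : ℕ) + 1)) f (uPerturbation β f) := by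
  have key (s : Fin d → ℤ) : (uPerturbation β f).coeff s =
      iota (f.coeff s) * uPow (∑ k, s k • β ^ ((k : ℕ) + 1)) := by
    rw [uPerturbation, coeff_substUnits_scaledVar, coeff_extendScalars, prod_uPow_zpow]
  refine ⟨fun s => ?_, fun s hs => ?_⟩
  · rw [key, mul_eq_zero, or_iff_left (uPow_ne_zero _), map_eq_zero]
  · rw [key, val₂_mul ((map_ne_zero iota).2 hs) (uPow_ne_zero _), val₂_iota hs, val₂_uPow,
      ← toLex_add, Prod.mk_add_mk, add_zero, zero_add]

/-! ### Minimizers along a ray -/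

section Minimizers

variable {K : Type*} [Field K] {d : ℕ}

/-- The linear form `p ↦ ⟨s, p⟩` on `ℝ ^ d` given by an exponent `s`. -/
def pairing (s : Fin d → ℤ) : (Fin d → ℝ) →ₗ[ℝ] ℝ where
  toFun p := ∑ i, s i • p i
  map_add' p q := by simp [Finset.sum_add_distrib]
  map_smul' a p := by simp [Finset.mul_sum, mul_left_comm]

theorem tropTerm_eq (v : K → ℝ) (f : Laurent K d) (p : Fin d → ℝ) (s : Fin d → ℤ) :
    tropTerm v f p s = v (f.coeff s) + pairing s p := rfl

theorem tropTerm_add_smul (v : K → ℝ) (f : Laurent K d) (p y : Fin d → ℝ) (ε : ℝ)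
    (s : Fin d → ℤ) : tropTerm v f (p + ε • y) s = tropTerm v f p s + ε * pairing s y := by
  simp [tropTerm_eq, add_assoc]

theorem tropTerm_combo (v : K → ℝ) (f : Laurent K d) (p q : Fin d → ℝ) {a b : ℝ}
    (hab : a + b = 1) (s : Fin d → ℤ) :
    tropTerm v f (a • p + b • q) s = a * tropTerm v f p s + b * tropTerm v f q s := by
  simp only [tropTerm_eq, map_add, map_smul, smul_eq_mul]
  linear_combination (-v (f.coeff s)) * hab

/-- The subspace `A^⊥` of the `y` for which `⟨s, y⟩` is the same for all `s ∈ A`. -/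
def equalizer (A : Set (Fin d → ℤ)) : Submodule ℝ (Fin d → ℝ) where
  carrier := {y | ∀ s ∈ A, ∀ s' ∈ A, pairing s y = pairing s' y}
  add_mem' hx hy s hs s' hs' := by rw [map_add, map_add, hx s hs s' hs', hy s hs s' hs']
  zero_mem' s _ s' _ := by rw [map_zero, map_zero]
  smul_mem' a y hy s hs s' hs' := by rw [map_smul, map_smul, hy s hs s' hs']

/-- The exponents in the support of `f` that minimize `⟨s, y⟩` among the minimizers of `trop f`
at `p`, written with the lexicographic order. -/
def lexMinimizers (v : K → ℝ) (f : Laurent K d) (p y : Fin d → ℝ) : Set (Fin d → ℤ) :=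
  {s | s ∈ f.coeff.support ∧ ∀ s' ∈ f.coeff.support,
    toLex (tropTerm v f p s, pairing s y) ≤ toLex (tropTerm v f p s', pairing s' y)}

theorem lexMinimizers_subset (v : K → ℝ) (f : Laurent K d) (p y : Fin d → ℝ) :
    lexMinimizers v f p y ⊆ minimizers v f p := fun _ hs =>
  ⟨hs.1, fun s' hs' => (Prod.Lex.toLex_le_toLex.1 (hs.2 s' hs')).elim le_of_lt fun h => h.1.le⟩

theorem mem_equalizer_lexMinimizers (v : K → ℝ) (f : Laurent K d) (p y : Fin d → ℝ) :
    y ∈ equalizer (lexMinimizers v f p y) := fun s hs s' hs' =>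
  congrArg (fun e : ℝ ×ₗ ℝ => (ofLex e).2)
    (le_antisymm (hs.2 s' hs'.1) (hs'.2 s hs.1))

theorem lexMinimizers_of_mem_equalizer {v : K → ℝ} {f : Laurent K d} {p y : Fin d → ℝ}
    (hy : y ∈ equalizer (minimizers v f p)) : lexMinimizers v f p y = minimizers v f p := by
  refine (lexMinimizers_subset v f p y).antisymm fun s hs => ⟨hs.1, fun s' hs' => ?_⟩
  rw [Prod.Lex.toLex_le_toLex]
  rcases (hs.2 s' hs').lt_or_eq with h | h
  · exact Or.inl h
  · exact Or.inr ⟨h, (hy s hs s' ⟨hs', fun t ht => h ▸ hs.2 t ht⟩).le⟩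

/-- The lexicographic order of pairs is the order of `x + ε y` for small `ε > 0`. -/
theorem eventually_add_mul_le_iff (x y x' y' : ℝ) :
    ∀ᶠ ε : ℝ in 𝓝[>] 0, x + ε * y ≤ x' + ε * y' ↔ toLex (x, y) ≤ toLex (x', y') := by
  have hlim (a b : ℝ) : Tendsto (fun ε : ℝ => a + ε * b) (𝓝[>] 0) (𝓝 a) := by
    have h : Continuous fun ε : ℝ => a + ε * b := by fun_prop
    simpa using (h.tendsto 0).mono_left nhdsWithin_le_nhds
  simp only [Prod.Lex.toLex_le_toLex]
  rcases lt_trichotomy x x' with h | rfl | h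
  · filter_upwards [(hlim x y).eventually_lt (hlim x' y') h] with ε hε
    simp [h, hε.le]
  · filter_upwards [self_mem_nhdsWithin] with ε hε
    simp [mul_le_mul_iff_right₀ (Set.mem_Ioi.1 hε)]
  · filter_upwards [(hlim x' y').eventually_lt (hlim x y) h] with ε hε
    simp [hε, h.not_gt, h.ne']

theorem eventually_minimizers_eq (v : K → ℝ) (f : Laurent K d) (p y : Fin d → ℝ) :
    ∀ᶠ ε : ℝ in 𝓝[>] 0, minimizers v f (p + ε • y) = lexMinimizers v f p y := by
  have h : ∀ᶠ ε : ℝ in 𝓝[>] 0, ∀ s ∈ f.coeff.support, ∀ s' ∈ f.coeff.support,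
      (tropTerm v f (p + ε • y) s ≤ tropTerm v f (p + ε • y) s' ↔
        toLex (tropTerm v f p s, pairing s y) ≤ toLex (tropTerm v f p s', pairing s' y)) := by
    simp_rw [Filter.eventually_all_finset, tropTerm_add_smul]
    exact fun s _ s' _ => eventually_add_mul_le_iff _ _ _ _
  filter_upwards [h] with ε hε
  ext s
  exact and_congr_right fun hs => forall₂_congr fun s' hs' => hε s hs s' hs'

theorem minimizers_combo {v : K → ℝ} {f : Laurent K d} {p q : Fin d → ℝ}
    (h : (minimizers v f p ∩ minimizers v f q).Nonempty) {a b : ℝ} (ha : 0 < a) (hb : 0 < b)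
    (hab : a + b = 1) :
    minimizers v f (a • p + b • q) = minimizers v f p ∩ minimizers v f q := by
  obtain ⟨t, htp, htq⟩ := h
  ext s
  constructor
  · rintro ⟨hs, hmin⟩
    have h1 := hmin t htp.1
    rw [tropTerm_combo v f p q hab, tropTerm_combo v f p q hab] at h1
    have h2 := htp.2 s hs
    have h3 := htq.2 s hs
    refine ⟨⟨hs, fun s' hs' => le_trans ?_ (htp.2 s' hs')⟩,
      ⟨hs, fun s' hs' => le_trans ?_ (htq.2 s' hs')⟩⟩
    · exact le_of_mul_le_mul_left (by linarith [mul_le_mul_of_nonneg_left h3 hb.le]) ha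
    · exact le_of_mul_le_mul_left (by linarith [mul_le_mul_of_nonneg_left h2 ha.le]) hb
  · rintro ⟨hp, hq⟩
    refine ⟨hp.1, fun s' hs' => ?_⟩
    rw [tropTerm_combo v f p q hab, tropTerm_combo v f p q hab]
    exact add_le_add (mul_le_mul_of_nonneg_left (hp.2 s' hs') ha.le)
      (mul_le_mul_of_nonneg_left (hq.2 s' hs') hb.le)

theorem finite_range_minimizers (v : K → ℝ) (f : Laurent K d) :
    (Set.range (minimizers v f)).Finite :=
  f.coeff.support.finite_toSet.finite_subsets.subset <| by
    rintro _ ⟨p, rfl⟩ s hs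
    exact hs.1

/-! ### Cells and their direction spaces -/

/-- A nonempty support cell is the support cell of the set of minimizers at a generic point. -/
theorem exists_supportCell_eq {v : K → ℝ} {f : Laurent K d} {S : Set (Fin d → ℤ)}
    (hS : S.Nonempty) (hP : (supportCell v f S).Nonempty) :
    ∃ q ∈ supportCell v f S, supportCell v f S = supportCell v f (minimizers v f q) := by
  have hfin (q : Fin d → ℝ) : (minimizers v f q).Finite :=
    f.coeff.support.finite_toSet.subset fun s hs => hs.1
  -- The generic point is one with as few minimizers as possible.
  obtain ⟨q, hq, hmin⟩ := exists_minimalFor_of_wellFoundedLT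
    (· ∈ supportCell v f S) (fun q => (minimizers v f q).ncard) hP
  refine ⟨q, hq, Set.Subset.antisymm (fun p hp => ?_) fun p hp => Set.Subset.trans hq hp⟩
  have hpq := minimizers_combo (hS.mono (Set.subset_inter hp hq)) (one_half_pos (α := ℝ))
    one_half_pos (add_halves 1)
  have hle := hmin (j := (1 / 2 : ℝ) • p + (1 / 2 : ℝ) • q)
    (hpq ▸ Set.subset_inter hp hq : S ⊆ _)
  simp only [hpq] at hle
  have := Set.eq_of_subset_of_ncard_le Set.inter_subset_right
    (hle (Set.ncard_le_ncard Set.inter_subset_right (hfin q))) (hfin q)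
  exact Set.inter_eq_right.1 this

theorem sub_mem_equalizer {v : K → ℝ} {f : Laurent K d} {S : Set (Fin d → ℤ)}
    {p q : Fin d → ℝ} (hp : p ∈ supportCell v f S) (hq : q ∈ supportCell v f S) :
    p - q ∈ equalizer S := by
  have key {p : Fin d → ℝ} (hp : p ∈ supportCell v f S) {s s' : Fin d → ℤ} (hs : s ∈ S)
      (hs' : s' ∈ S) : tropTerm v f p s = tropTerm v f p s' :=
    le_antisymm ((hp hs).2 s' (hp hs').1) ((hp hs').2 s (hp hs).1)
  intro s hs s' hs'
  have h1 := key hp hs hs'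
  have h2 := key hq hs hs'
  rw [tropTerm_eq, tropTerm_eq] at h1 h2
  rw [map_sub, map_sub]
  linarith

/-- The cell of the minimizers at `q` contains a neighbourhood of `q` in `q + A^⊥`. -/
theorem equalizer_le_vectorSpan (v : K → ℝ) (f : Laurent K d) (q : Fin d → ℝ) :
    equalizer (minimizers v f q) ≤ vectorSpan ℝ (supportCell v f (minimizers v f q)) := by
  intro y hy
  have hev := eventually_minimizers_eq v f q y
  rw [lexMinimizers_of_mem_equalizer hy] at hev
  obtain ⟨ε, hε, hpos⟩ := (hev.and self_mem_nhdsWithin).exists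
  have h := vsub_mem_vectorSpan ℝ (s := supportCell v f (minimizers v f q))
    (p₁ := q + ε • y) (p₂ := q) hε.ge Set.Subset.rfl
  rw [vsub_eq_sub, add_sub_cancel_left] at h
  exact (Submodule.smul_mem_iff _ (ne_of_gt hpos)).1 h

end Minimizers

theorem vectorSpan_le_vectorSpan_add {V : Type*} [AddCommGroup V] [Module ℝ V] {P Q : Set V}
    (hQ : Q.Nonempty) : vectorSpan ℝ P ≤ vectorSpan ℝ (P + Q) := by
  obtain ⟨c, hc⟩ := hQ
  refine Submodule.span_le.2 ?_
  rintro _ ⟨a, ha, b, hb, rfl⟩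
  have h := vsub_mem_vectorSpan ℝ (Set.add_mem_add ha hc) (Set.add_mem_add hb hc)
  rwa [vsub_eq_sub, add_sub_add_right_eq_sub] at h

theorem polyDim_eq_iff {d : ℕ} (P : Set (Fin d → ℝ)) : polyDim P = d ↔ vectorSpan ℝ P = ⊤ := by
  constructor
  · exact fun h => Submodule.eq_top_of_finrank_eq (h.trans (Module.finrank_fin_fun ℝ).symm)
  · intro h
    rw [polyDim, h, finrank_top, Module.finrank_fin_fun]

section DirectionSpaces

variable {K : Type*} [Field K] {d : ℕ}

theorem polyDim_add_eq_iff {v : K → ℝ} {f g : Laurent K d} (q r : Fin d → ℝ) :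
    polyDim (supportCell v f (minimizers v f q) + supportCell v g (minimizers v g r)) = d ↔
      equalizer (minimizers v f q) ⊔ equalizer (minimizers v g r) = ⊤ := by
  have hq : q ∈ supportCell v f (minimizers v f q) := Set.Subset.rfl
  have hr : r ∈ supportCell v g (minimizers v g r) := Set.Subset.rfl
  rw [polyDim_eq_iff]
  suffices h : vectorSpan ℝ
      (supportCell v f (minimizers v f q) + supportCell v g (minimizers v g r)) =
        equalizer (minimizers v f q) ⊔ equalizer (minimizers v g r) by rw [h]
  refine le_antisymm (Submodule.span_le.2 ?_) (sup_le ?_ ?_)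
  · rintro _ ⟨_, ⟨a, ha, b, hb, rfl⟩, _, ⟨a', ha', b', hb', rfl⟩, rfl⟩
    change a + b - (a' + b') ∈ _
    rw [add_sub_add_comm]
    exact Submodule.add_mem_sup (sub_mem_equalizer ha ha') (sub_mem_equalizer hb hb')
  · exact (equalizer_le_vectorSpan v f q).trans (vectorSpan_le_vectorSpan_add ⟨r, hr⟩)
  · rw [add_comm]
    exact (equalizer_le_vectorSpan v g r).trans (vectorSpan_le_vectorSpan_add ⟨q, hq⟩)

end DirectionSpaces

/-! ### The closure of a rank two tropical hypersurface -/

theorem mem_trop₂_iff {d : ℕ} {w : Fin d → ℝ} {f : Laurent Puiseux₁ d} {F : Laurent Puiseux₂ d}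
    (hF : IsTropicalPerturbation w f F) (p : Fin d → ℝ × ℝ) :
    p ∈ trop₂ F ↔ (lexMinimizers val₁ f (projU p) ((fun i => (p i).2) + w)).Nontrivial := by
  have hsupp (s : Fin d → ℤ) : s ∈ F.coeff.support ↔ s ∈ f.coeff.support := by
    rw [Finsupp.mem_support_iff, Finsupp.mem_support_iff, Ne, Ne, hF.1]
  have hterm (s : Fin d → ℤ) (hs : s ∈ f.coeff.support) :
      tropTerm val₂ F (fun i => toLex (p i)) s = toLex (tropTerm val₁ f (projU p) s,
        pairing s ((fun i => (p i).2) + w)) := by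
    have hsum : ∑ i, s i • toLex (p i) =
        toLex (∑ i, s i • (p i).1, ∑ i, s i • (p i).2) := by
      change toLex (∑ i, s i • p i) = _
      exact congrArg toLex (Prod.ext (by simp [Prod.fst_sum]) (by simp [Prod.snd_sum]))
    rw [tropTerm, hF.2 s (Finsupp.mem_support_iff.1 hs), hsum, ← toLex_add, Prod.mk_add_mk,
      map_add, add_comm (pairing s _)]
    rfl
  have h : minimizers val₂ F (fun i => toLex (p i)) =
      lexMinimizers val₁ f (projU p) ((fun i => (p i).2) + w) := by
    ext s
    constructor
    · rintro ⟨hs, hmin⟩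
      refine ⟨(hsupp s).1 hs, fun s' hs' => ?_⟩
      rw [← hterm s ((hsupp s).1 hs), ← hterm s' hs']
      exact hmin s' ((hsupp s').2 hs')
    · rintro ⟨hs, hmin⟩
      refine ⟨(hsupp s).2 hs, fun s' hs' => ?_⟩
      rw [hterm s hs, hterm s' ((hsupp s').1 hs')]
      exact hmin s' ((hsupp s').1 hs')
  change (minimizers val₂ F (fun i => toLex (p i))).Nontrivial ↔ _
  rw [h]

theorem isClosed_supportCell {K : Type*} [Field K] {d : ℕ} (v : K → ℝ) (f : Laurent K d)
    (S : Set (Fin d → ℤ)) : IsClosed (supportCell v f S) := by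
  have hcont (s : Fin d → ℤ) : Continuous fun p => tropTerm v f p s := by
    unfold tropTerm
    fun_prop
  have h : supportCell v f S = ⋂ s ∈ S, {p | s ∈ f.coeff.support} ∩
      ⋂ s' ∈ f.coeff.support, {p | tropTerm v f p s ≤ tropTerm v f p s'} := by
    ext p
    simp [supportCell, minimizers, Set.subset_def]
  rw [h]
  exact isClosed_biInter fun s _ => isClosed_const.inter <|
    isClosed_biInter fun s' _ => isClosed_le (hcont s) (hcont s')

/-- The closure of `T₂(F)` is the union of the products `P_A × (A^⊥ - w)`, where `A` runs over the
sets of minimizers of `f` with more than one element, and `P_A` is the support cell of `A`. -/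
theorem mem_closure_trop₂_iff {d : ℕ} {w : Fin d → ℝ} {f : Laurent Puiseux₁ d}
    {F : Laurent Puiseux₂ d} (hF : IsTropicalPerturbation w f F) (p : Fin d → ℝ × ℝ) :
    p ∈ closure (trop₂ F) ↔ ∃ q : Fin d → ℝ, (minimizers val₁ f q).Nontrivial ∧
      projU p ∈ supportCell val₁ f (minimizers val₁ f q) ∧
      (fun i => (p i).2) + w ∈ equalizer (minimizers val₁ f q) := by
  have hfst : Continuous (projU (d := d)) := by unfold projU; fun_prop
  have hsnd : Continuous fun p : Fin d → ℝ × ℝ => (fun i => (p i).2) + w := by fun_prop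
  constructor
  · intro hp
    let Z : Set (Fin d → ℤ) → Set (Fin d → ℝ × ℝ) := fun A =>
      {p | projU p ∈ supportCell val₁ f A ∧ (fun i => (p i).2) + w ∈ equalizer A}
    have hZ (A) : IsClosed (Z A) :=
      ((isClosed_supportCell val₁ f A).preimage hfst).inter
        ((equalizer A).closed_of_finiteDimensional.preimage hsnd)
    have hclosed : IsClosed
        (⋃ A ∈ Set.range (minimizers val₁ f) ∩ {A | A.Nontrivial}, Z A) :=
      ((finite_range_minimizers val₁ f).inter_of_left _).isClosed_biUnion fun A _ => hZ A
    have hsub : trop₂ F ⊆ ⋃ A ∈ Set.range (minimizers val₁ f) ∩ {A | A.Nontrivial}, Z A := by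
      intro p hp
      rw [mem_trop₂_iff hF] at hp
      obtain ⟨ε, hε⟩ := (eventually_minimizers_eq val₁ f (projU p)
        ((fun i => (p i).2) + w)).exists
      exact Set.mem_biUnion ⟨⟨_, hε⟩, hp⟩
        ⟨lexMinimizers_subset _ _ _ _, mem_equalizer_lexMinimizers _ _ _ _⟩
    obtain ⟨A, ⟨⟨q, rfl⟩, hA⟩, hpA⟩ := Set.mem_iUnion₂.1 (closure_minimal hsub hclosed hp)
    exact ⟨q, hA, hpA.1, hpA.2⟩
  · rintro ⟨q, hA, hp, hy⟩
    -- The first coordinate moves from `projU p` towards `q`, the second one stays.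
    let γ : ℝ → Fin d → ℝ × ℝ := fun ε i => ((1 - ε) * (p i).1 + ε * q i, (p i).2)
    have hγ : Tendsto γ (𝓝[>] 0) (𝓝 p) := by
      have h : Continuous γ := by fun_prop
      have h0 : γ 0 = p := by ext i <;> simp [γ]
      exact h0 ▸ (h.tendsto 0).mono_left nhdsWithin_le_nhds
    refine mem_closure_of_tendsto hγ ?_
    filter_upwards [Ioo_mem_nhdsGT (zero_lt_one (α := ℝ))] with ε hε
    have hmin : minimizers val₁ f (projU (γ ε)) = minimizers val₁ f q := by
      have h := minimizers_combo (a := 1 - ε) (b := ε)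
        (hA.nonempty.mono (Set.subset_inter hp Set.Subset.rfl))
        (sub_pos.2 hε.2) hε.1 (sub_add_cancel 1 ε)
      rw [Set.inter_eq_right.2 hp] at h
      exact h
    rw [mem_trop₂_iff hF]
    have hy' : (fun i => (γ ε i).2) + w ∈ equalizer (minimizers val₁ f (projU (γ ε))) := by
      rw [hmin]; exact hy
    rw [lexMinimizers_of_mem_equalizer hy', hmin]
    exact hA

/-! ### Rational subspaces and generic vectors -/

theorem linearIndependent_pow_succ {β : ℝ} (hβ : Transcendental ℚ β) (d : ℕ) :
    LinearIndependent ℚ fun k : Fin d => β ^ ((k : ℕ) + 1) := by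
  have hinj := transcendental_iff_injective.1 hβ
  have h := (Polynomial.basisMonomials ℚ).linearIndependent.map' (Polynomial.aeval β).toLinearMap
    (LinearMap.ker_eq_bot.2 hinj)
  have h' := h.comp (fun k : Fin d => (k : ℕ) + 1)
    fun a b hab => Fin.ext (Nat.succ_injective hab)
  have heq : (fun k : Fin d => β ^ ((k : ℕ) + 1)) =
      ((Polynomial.aeval β).toLinearMap ∘ Polynomial.basisMonomials ℚ) ∘
        fun k : Fin d => (k : ℕ) + 1 := by
    ext k
    simp
  exact heq ▸ h'

/-- A sum of two rational subspaces that contains a vector with coordinates linearly independent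
over `ℚ` is everything: applying to the coordinates a `ℚ`-linear map preserves the two subspaces,
and suitable maps send the vector to the standard basis vectors. -/
theorem equalizer_sup_eq_top {d : ℕ} {w : Fin d → ℝ} (hw : LinearIndependent ℚ w)
    {A B : Set (Fin d → ℤ)} (h : w ∈ equalizer A ⊔ equalizer B) :
    equalizer A ⊔ equalizer B = ⊤ := by
  obtain ⟨a, ha, b, hb, rfl⟩ := Submodule.mem_sup.1 h
  have hpres (φ : ℝ →ₗ[ℚ] ℝ) {A : Set (Fin d → ℤ)} {y : Fin d → ℝ} (hy : y ∈ equalizer A) :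
      (fun i => φ (y i)) ∈ equalizer A := by
    have key (s : Fin d → ℤ) : pairing s (fun i => φ (y i)) = φ (pairing s y) := by
      change ∑ i, s i • φ (y i) = φ (∑ i, s i • y i)
      rw [map_sum]
      simp_rw [map_zsmul]
    intro s hs s' hs'
    rw [key, key, hy s hs s' hs']
  have hsingle (k : Fin d) : (Pi.single k 1 : Fin d → ℝ) ∈ equalizer A ⊔ equalizer B := by
    obtain ⟨φ, hφ⟩ := LinearMap.exists_extend
      ((Module.Basis.span hw).constr ℚ (Pi.single k (1 : ℝ)))
    have hφw : (Pi.single k 1 : Fin d → ℝ) = (fun i => φ (a i)) + fun i => φ (b i) := by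
      ext i
      have h1 := LinearMap.congr_fun hφ (Module.Basis.span hw i)
      rw [Module.Basis.constr_basis, LinearMap.comp_apply, Submodule.subtype_apply,
        Module.Basis.span_apply] at h1
      exact h1.symm.trans (map_add φ (a i) (b i))
    rw [hφw]
    exact Submodule.add_mem_sup (hpres φ ha) (hpres φ hb)
  rw [eq_top_iff, ← (Pi.basisFun ℝ (Fin d)).span_eq, Submodule.span_le]
  rintro _ ⟨k, rfl⟩
  rw [Pi.basisFun_apply]
  exact hsingle k

/-! ### The stable intersection -/

theorem stableIntersection_eq_image_projU {β : ℝ} (hβ : Transcendental ℚ β) {d : ℕ}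
    (f g : Laurent Puiseux₁ d) :
    stableIntersection f g =
      projU '' (closure (trop₂ (extendScalars f)) ∩ closure (trop₂ (uPerturbation β g))) := by
  have hf := mem_closure_trop₂_iff (isTropicalPerturbation_extendScalars f)
  have hg := mem_closure_trop₂_iff (isTropicalPerturbation_uPerturbation β g)
  ext p
  constructor
  · rintro ⟨P, ⟨hP, S, hSsupp, hS, rfl⟩, Q, ⟨hQ, T, hTsupp, hT, rfl⟩, hdim, hpP, hpQ⟩
    obtain ⟨q, hqS, hq⟩ := exists_supportCell_eq hS.nonempty hP
    obtain ⟨r, hrT, hr⟩ := exists_supportCell_eq hT.nonempty hQ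
    rw [hq, hr, polyDim_add_eq_iff] at hdim
    have hw : (fun k : Fin d => β ^ ((k : ℕ) + 1)) ∈
        equalizer (minimizers val₁ f q) ⊔ equalizer (minimizers val₁ g r) :=
      hdim ▸ Submodule.mem_top
    obtain ⟨a, ha, b, hb, hab⟩ := Submodule.mem_sup.1 hw
    -- Write `(β ^ k)_k = a + b` with `a ∈ A^⊥` and `b ∈ B^⊥`; the second coordinate is `-a`.
    refine ⟨fun i => (p i, -a i), ⟨(hf _).2 ⟨q, hS.mono hqS, hq ▸ hpP, ?_⟩,
      (hg _).2 ⟨r, hT.mono hrT, hr ▸ hpQ, ?_⟩⟩, rfl⟩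
    · rw [add_zero]
      exact neg_mem ha
    · rw [← hab]
      convert hb using 1
      ext i
      simp
  · rintro ⟨p, ⟨hpf, hpg⟩, rfl⟩
    obtain ⟨q, hA, hpA, hya⟩ := (hf p).1 hpf
    obtain ⟨r, hB, hpB, hyb⟩ := (hg p).1 hpg
    refine ⟨_, ⟨⟨_, hpA⟩, _, fun s hs => hs.1, hA, rfl⟩,
      _, ⟨⟨_, hpB⟩, _, fun s hs => hs.1, hB, rfl⟩,
      (polyDim_add_eq_iff q r).2 (equalizer_sup_eq_top (linearIndependent_pow_succ hβ d) ?_),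
      hpA, hpB⟩
    have h := Submodule.add_mem_sup (neg_mem hya) hyb
    rwa [add_zero, neg_add_cancel_left] at h

end RankTwo

theorem theorem4p4 (β : ℝ) (hβ : 0 < β) (hβ_tr : Transcendental ℚ β) (d : ℕ)
    (f g : RankTwo.Laurent RankTwo.Puiseux₁ d) :
    RankTwo.stableIntersection f g =
      RankTwo.projU ''
        (closure (RankTwo.trop₂ (RankTwo.extendScalars f)) ∩
          closure (RankTwo.trop₂ (RankTwo.uPerturbation β g))) :=
  RankTwo.stableIntersection_eq_image_projU hβ_tr f g
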